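/- Let $S\subset\mathbb{R}^3$ be an embedded $C^\infty$ surface without boundary (for instance a compact real analytic one), with the Riemannian metric induced by $\mathbb{R}^3$, and let $b\in S$. Let $d_b$ be the Riemannian distance to $b$ in $S$, and let the cut locus $Cut_b(S)$ be the closure in $S$ of the set of points of $S$ that are joined to $b$ by at least two minimizing geodesics. For $x\in S\setminus\{b\}$ in the same connected component of $S$ as $b$, the norm of the generalized gradient of $d_b$ at $x$ is $$|\nabla_S d_b|(x)=\max\Big(0,\ \sup_{v\in T_xS,\ |v|=1}\partial_v^+d_b(x)\Big),\qquad \partial_v^+d_b(x)=\limsup_{t\to0^+}\frac{d_b(\exp_x(tv))-d_b(x)}{t},$$ where $\exp_x$ is the Riemannian exponential map of $S$ at $x$ (the upper limit is in fact a limit). Let $x\in Cut_b(S)$, and let $\gamma_1,\gamma_2:[0,d_b(x)]\to S$ be two unit-speed minimizing geodesics with $\gamma_i(0)=b$ and $\gamma_i(d_b(x))=x$ for $i=1,2$. Suppose that the angle $\theta$ between $\gamma_1$ and $\gamma_2$ at $x$, that is, the angle between the vectors $-\dot\gamma_1(d_b(x))$ and $-\dot\gamma_2(d_b(x))$, lies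 in $(0,\pi)$. Then $$|\nabla_S d_b|(x)\le\cos(\theta/2).$$ -/

import Mathlib

open Set Filter Topology MeasureTheory
open scoped ContDiff

noncomputable section

namespace CutLocus

/-- Euclidean three-space. -/
abbrev E3 := EuclideanSpace ℝ (Fin 3)

/-- `S` is an embedded surface without boundary in `ℝ³`, of class `C^n` (`n = ∞`: smooth,
`n = ω`: real analytic): around each of its points there is a `C^n` diffeomorphism between open
subsets of `ℝ³` that straightens `S` to the coordinate plane `{q | q 2 = 0}`. -/
def IsSurface (n : WithTop ℕ∞) (S : Set E3) : Prop :=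
  ∀ p ∈ S, ∃ Φ : OpenPartialHomeomorph E3 E3,
    p ∈ Φ.source ∧ ContDiffOn ℝ n Φ Φ.source ∧ ContDiffOn ℝ n Φ.symm Φ.target ∧
      ∀ q ∈ Φ.source, q ∈ S ↔ Φ q 2 = 0

/-- The tangent space `T_p S`: velocities at `p` of smooth curves in `S` through `p`. -/
def tangentSet (S : Set E3) (p : E3) : Set E3 :=
  {v | ∃ c : ℝ → E3, ContDiffAt ℝ ∞ c 0 ∧ (∀ᶠ t in 𝓝 0, c t ∈ S) ∧ c 0 = p ∧ deriv c 0 = v}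

/-- The Riemannian distance of `S` for the metric induced by `ℝ³`, with values in `[0, ∞]`: the
infimum of the lengths of the `C¹` curves in `S` from `p` to `q`. -/
def surfaceEDist (S : Set E3) (p q : E3) : ENNReal :=
  ⨅ (c : ℝ → E3) (_ : ContDiffOn ℝ 1 c (Icc 0 1) ∧ (∀ t ∈ Icc (0 : ℝ) 1, c t ∈ S) ∧
      c 0 = p ∧ c 1 = q),
    ∫⁻ t in Icc (0 : ℝ) 1, ‖derivWithin c (Icc 0 1) t‖ₑ

/-- The distance `d_b(x)` in `S` as a real number; it is only used for points in the same
component of `S`, where `surfaceEDist` is finite. -/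
def surfaceDist (S : Set E3) (b x : E3) : ℝ := (surfaceEDist S b x).toReal

/-- The velocity at time `t` of a curve defined on `[0, L]` (one-sided at the end points). -/
def velocity (L : ℝ) (c : ℝ → E3) (t : ℝ) : E3 := derivWithin c (Icc 0 L) t

/-- `c : [0, L] → S` is a geodesic of `S`: its acceleration in `ℝ³` is normal to `S`, that is, the
covariant derivative of its velocity vanishes. -/
def IsGeodesic (S : Set E3) (L : ℝ) (c : ℝ → E3) : Prop :=
  ContDiffOn ℝ 2 c (Icc 0 L) ∧ ∀ t ∈ Icc 0 L, c t ∈ S ∧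
    ∀ w ∈ tangentSet S (c t), inner ℝ (derivWithin (velocity L c) (Icc 0 L) t) w = 0

/-- `c : [0, d_b(x)] → S` is a unit-speed minimizing geodesic from `b` to `x`. It is minimizing
since its length is the length `d_b(x)` of its interval of definition. The unit speed condition
forces `0 < d_b(x)`, as `derivWithin` vanishes on a one-point interval. -/
def IsUnitSpeedMinGeodesic (S : Set E3) (b x : E3) (c : ℝ → E3) : Prop :=
  IsGeodesic S (surfaceDist S b x) c ∧
    (∀ t ∈ Icc 0 (surfaceDist S b x), ‖velocity (surfaceDist S b x) c t‖ = 1) ∧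
    c 0 = b ∧ c (surfaceDist S b x) = x

/-- The cut locus `Cut_b(S)`: the closure in `S` of the set of points of `S` that are joined to
`b` by at least two minimizing geodesics. -/
def cutLocus (S : Set E3) (b : E3) : Set E3 :=
  S ∩ closure {p | p ∈ S ∧ ∃ c₁ c₂ : ℝ → E3,
    IsUnitSpeedMinGeodesic S b p c₁ ∧ IsUnitSpeedMinGeodesic S b p c₂ ∧
      ¬ EqOn c₁ c₂ (Icc 0 (surfaceDist S b p))}

open Classical in
/-- The Riemannian exponential map `exp_x` of `S`: the value at time `1` of the geodesic with
initial point `x` and initial velocity `w` (with the default value `x` where there is no such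
geodesic on `[0, 1]`, which does not happen for small tangent vectors `w`). -/
def expMap (S : Set E3) (x w : E3) : E3 :=
  if h : ∃ c : ℝ → E3, IsGeodesic S 1 c ∧ c 0 = x ∧ velocity 1 c 0 = w then h.choose 1 else x

/-- The one-sided directional derivative `∂⁺_v f(x)` along `t ↦ exp_x(t v)`, as an upper limit in
the extended reals, which is the limit whenever the limit exists. -/
def dirDeriv (S : Set E3) (f : E3 → ℝ) (x v : E3) : EReal :=
  limsup (fun t : ℝ => (((f (expMap S x (t • v)) - f x) / t : ℝ) : EReal)) (𝓝[>] 0)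

/-- The norm of the generalized gradient of `f` on `S` at `x`:
`max(0, sup {∂⁺_v f(x) : v ∈ T_x S, |v| = 1})`. -/
def genGradNorm (S : Set E3) (f : E3 → ℝ) (x : E3) : EReal :=
  max 0 (⨆ v ∈ {v : E3 | v ∈ tangentSet S x ∧ ‖v‖ = 1}, dirDeriv S f x v)

end CutLocus

end

/-!
The bound is a first variation argument. Let `u` be the final velocity at `x` of a unit-speed
minimizing geodesic `γ` of length `d = d_b(x)`. A competitor from `b` to `exp_x(t v)` follows `γ` up
to `γ(d - k t)` and then takes a shortcut in `S`. Since `exp_x` has the identity as differential at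
`0` and the distance of `S` agrees with the chordal distance to first order, the shortcut has length
`t ‖k u + v‖ + o(t)`, and `‖k u + v‖ = k + ⟪u, v⟫ + O(1 / k)` for large `k`. Hence
`∂⁺_v d_b(x) ≤ ⟪u, v⟫`. For the two final velocities `u₁`, `u₂`, at angle `θ`, the identity
`‖u₁ + u₂‖ = 2 cos (θ / 2)` shows that one of `⟪u₁, v⟫`, `⟪u₂, v⟫` is at most `cos (θ / 2)`.

To control `exp_x` without solving the geodesic equation, the acceleration of a geodesic is bounded
by a multiple of its squared speed, by differentiating a local equation of `S` twice along it.
-/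

namespace CutLocus

open AffineMap Manifold
open scoped NNReal

section InnerProductSpace

variable {V : Type*} [NormedAddCommGroup V] [InnerProductSpace ℝ V]

lemma norm_apply_of_mem_orthogonal_ker [CompleteSpace V] (G : StrongDual ℝ V) {a : V}
    (ha : a ∈ G.kerᗮ) : ‖G a‖ = ‖G‖ * ‖a‖ := by
  set ν : V := (InnerProductSpace.toDual ℝ V).symm G with hν
  have apply_eq (w : V) : G w = inner ℝ ν w := InnerProductSpace.toDual_symm_apply.symm
  have ker_eq : G.ker = (ℝ ∙ ν)ᗮ := by
    ext w
    rw [LinearMap.mem_ker, Submodule.mem_orthogonal_singleton_iff_inner_right, ← apply_eq]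
    rfl
  rw [ker_eq, Submodule.orthogonal_orthogonal] at ha
  obtain ⟨k, rfl⟩ := Submodule.mem_span_singleton.1 ha
  have norm_eq : ‖G‖ = ‖ν‖ := by simp [hν]
  rw [apply_eq, inner_smul_right, real_inner_self_eq_norm_sq, norm_eq, norm_smul, norm_mul,
    norm_pow, norm_norm]
  ring

lemma eventually_norm_smul_add_lt {u v : V} (hu : ‖u‖ = 1) {a : ℝ} (ha : inner ℝ u v < a) :
    ∀ᶠ k : ℝ in atTop, ‖k • u + v‖ < k + a := by
  have hpos : 0 < 2 * (a - inner ℝ u v) := by linarith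
  filter_upwards [eventually_gt_atTop 0, eventually_gt_atTop (-a),
    eventually_gt_atTop (‖v‖ ^ 2 / (2 * (a - inner ℝ u v)))] with k hk hka hkv
  rw [div_lt_iff₀ hpos] at hkv
  refine lt_of_pow_lt_pow_left₀ 2 (by linarith) ?_
  rw [norm_add_sq_real, norm_smul, real_inner_smul_left, hu, Real.norm_of_nonneg hk.le]
  nlinarith [sq_nonneg a]

lemma norm_add_eq_two_mul_cos_half_angle {u₁ u₂ : V} (h₁ : ‖u₁‖ = 1) (h₂ : ‖u₂‖ = 1) :
    ‖u₁ + u₂‖ = 2 * Real.cos (InnerProductGeometry.angle u₁ u₂ / 2) := by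
  have hcos : 0 ≤ Real.cos (InnerProductGeometry.angle u₁ u₂ / 2) :=
    Real.cos_nonneg_of_mem_Icc
      ⟨by linarith [InnerProductGeometry.angle_nonneg u₁ u₂, Real.pi_pos],
        by linarith [InnerProductGeometry.angle_le_pi u₁ u₂]⟩
  rw [← sq_eq_sq₀ (norm_nonneg _) (by positivity), norm_add_sq_real, mul_pow, Real.cos_sq,
    mul_div_cancel₀ _ two_ne_zero, InnerProductGeometry.cos_angle, h₁, h₂]
  ring

lemma min_inner_le_cos_half_angle {u₁ u₂ v : V} (h₁ : ‖u₁‖ = 1) (h₂ : ‖u₂‖ = 1) (hv : ‖v‖ = 1) :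
    min (inner ℝ u₁ v) (inner ℝ u₂ v) ≤ Real.cos (InnerProductGeometry.angle u₁ u₂ / 2) := by
  have hsum : inner ℝ u₁ v + inner ℝ u₂ v ≤
      2 * Real.cos (InnerProductGeometry.angle u₁ u₂ / 2) := by
    calc inner ℝ u₁ v + inner ℝ u₂ v = inner ℝ (u₁ + u₂) v := inner_add_left .. |>.symm
      _ ≤ ‖u₁ + u₂‖ * ‖v‖ := real_inner_le_norm _ _
      _ = _ := by rw [hv, mul_one, norm_add_eq_two_mul_cos_half_angle h₁ h₂]
  by_contra! hlt
  rw [lt_min_iff] at hlt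
  linarith [hlt.1, hlt.2]

end InnerProductSpace

section Calculus

variable {E F : Type*} [NormedAddCommGroup E] [NormedSpace ℝ E]
  [NormedAddCommGroup F] [NormedSpace ℝ F]

lemma fderiv_comp_fderiv_of_eventually_leftInverse {f : E → F} {g : F → E} {x : E}
    (hf : DifferentiableAt ℝ f x) (hg : DifferentiableAt ℝ g (f x))
    (hgf : ∀ᶠ z in 𝓝 x, g (f z) = z) :
    (fderiv ℝ g (f x)).comp (fderiv ℝ f x) = ContinuousLinearMap.id ℝ E := by
  rw [← fderiv_comp x hg hf, ← fderiv_id (x := x)]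
  exact EventuallyEq.fderiv_eq hgf

lemma fderiv_derivWithin_eq_zero_of_eventually {f : E → F} {c : ℝ → E} {s : Set ℝ} {t : ℝ}
    (hf : DifferentiableAt ℝ f (c t)) (hc : DifferentiableWithinAt ℝ c s t) (ht : t ∈ s)
    (hfc : ∀ᶠ τ in 𝓝[s] t, f (c τ) = 0) : fderiv ℝ f (c t) (derivWithin c s t) = 0 := by
  have hcomp : f ∘ c =ᶠ[𝓝[s] t] fun _ => 0 := hfc
  rw [← fderivWithin_univ,
    ← fderivWithin_comp_derivWithin t hf.differentiableWithinAt hc (mapsTo_univ c s),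
    hcomp.derivWithin_eq (hfc.self_of_nhdsWithin ht), derivWithin_fun_const, Pi.zero_apply]

lemma fderiv_fderiv_add_fderiv_eq_zero_of_eventually {f : E → F} {c : ℝ → E} {s : Set ℝ} {t : ℝ}
    (hf : ContDiffAt ℝ 2 f (c t)) (hs : UniqueDiffOn ℝ s) (hc : ContDiffOn ℝ 2 c s) (ht : t ∈ s)
    (hfc : ∀ᶠ τ in 𝓝[s] t, f (c τ) = 0) :
    fderiv ℝ (fderiv ℝ f) (c t) (derivWithin c s t) (derivWithin c s t) +
      fderiv ℝ f (c t) (derivWithin (derivWithin c s) s t) = 0 := by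
  have hc₁ : DifferentiableOn ℝ c s := hc.differentiableOn (by norm_num)
  have hc₂ : DifferentiableOn ℝ (derivWithin c s) s :=
    (hc.derivWithin (m := 1) hs (by norm_num)).differentiableOn one_ne_zero
  have hf' : DifferentiableAt ℝ (fderiv ℝ f) (c t) :=
    (hf.fderiv_right (m := 1) (by norm_num)).differentiableAt one_ne_zero
  have hvel : ∀ᶠ τ in 𝓝[s] t, fderiv ℝ f (c τ) (derivWithin c s τ) = 0 := by
    filter_upwards [eventually_eventually_nhdsWithin.2 hfc, self_mem_nhdsWithin,
      (hc₁ t ht).continuousWithinAt.eventually (hf.eventually (by simp))] with τ hfcτ hτ hfτ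
    exact fderiv_derivWithin_eq_zero_of_eventually (hfτ.differentiableAt (by simp)) (hc₁ τ hτ) hτ
      hfcτ
  have hderiv := (hf'.hasFDerivAt.comp_hasDerivWithinAt t (hc₁ t ht).hasDerivWithinAt).clm_apply
    (hc₂ t ht).hasDerivWithinAt
  exact (hs t ht).eq_deriv _ hderiv <| (hasDerivWithinAt_const t s 0).congr_of_eventuallyEq hvel
    (hvel.self_of_nhdsWithin ht)

lemma norm_sub_sub_smul_derivWithin_le {c : ℝ → E} {a b C : ℝ} (hab : a < b)
    (hc : ContDiffOn ℝ 2 c (Icc a b))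
    (hC : ∀ t ∈ Icc a b, ‖derivWithin (derivWithin c (Icc a b)) (Icc a b) t‖ ≤ C) :
    ‖c b - c a - (b - a) • derivWithin c (Icc a b) a‖ ≤ C * (b - a) ^ 2 := by
  have iteratedDerivWithin_two (t : ℝ) : iteratedDerivWithin 2 c (Icc a b) t =
      derivWithin (derivWithin c (Icc a b)) (Icc a b) t := by
    rw [iteratedDerivWithin_succ, iteratedDerivWithin_one]
  have hT := taylor_mean_remainder_bound (n := 1) hab.le (mod_cast hc) (right_mem_Icc.2 hab.le)
    (fun t ht => (congrArg norm (iteratedDerivWithin_two t)).trans_le (hC t ht))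
  simpa [taylorWithinEval_succ, iteratedDerivWithin_one, sub_sub] using hT

lemma eventually_forall_lineMap_mem {x : E} {s : Set E} (hs : s ∈ 𝓝 x) :
    ∀ᶠ p in 𝓝 x ×ˢ 𝓝 x, ∀ t ∈ Icc (0 : ℝ) 1, lineMap p.1 p.2 t ∈ s := by
  obtain ⟨r, hr, hrs⟩ := Metric.mem_nhds_iff.1 hs
  filter_upwards [prod_mem_prod (Metric.ball_mem_nhds x hr) (Metric.ball_mem_nhds x hr)]
    with p hp t ht
  exact hrs ((convex_ball x r).lineMap_mem hp.1 hp.2 ht)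

/-- Both the chord and the velocities of the image of the segment are `fderiv ℝ f x (p.2 - p.1)` up
to a small multiple of `‖p.2 - p.1‖`, which is itself controlled by `‖fderiv ℝ f x (p.2 - p.1)‖`. -/
lemma eventually_norm_fderiv_lineMap_le {f : E → F} {x : E} (hf : ContDiffAt ℝ 1 f x) {K : ℝ≥0}
    (hK : AntilipschitzWith K (fderiv ℝ f x)) {C : ℝ} (hC : 1 < C) :
    ∀ᶠ p in 𝓝 x ×ˢ 𝓝 x, ∀ t ∈ Icc (0 : ℝ) 1,
      ‖fderiv ℝ f (lineMap p.1 p.2 t) (p.2 - p.1)‖ ≤ C * ‖f p.2 - f p.1‖ := by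
  set A := fderiv ℝ f x
  set δ : ℝ := (C - 1) / ((C + 1) * (K + 1)) with hδ
  have hC' : 0 < C - 1 := sub_pos.2 hC
  have hδ0 : 0 < δ := by positivity
  have hδK (w : E) : (C + 1) * (δ * ‖w‖) ≤ (C - 1) * ‖A w‖ := by
    calc (C + 1) * (δ * ‖w‖) ≤ (C + 1) * (δ * ((K + 1) * ‖A w‖)) := by
          gcongr
          linarith [(fderiv ℝ f x).bound_of_antilipschitz hK w, norm_nonneg (A w)]
      _ = (C - 1) * ‖A w‖ := by rw [hδ]; field_simp
  have hchord : ∀ᶠ p in 𝓝 x ×ˢ 𝓝 x, ‖f p.2 - f p.1 - A (p.2 - p.1)‖ ≤ δ * ‖p.2 - p.1‖ := by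
    have hstrict := (hf.hasStrictFDerivAt one_ne_zero).isLittleO.def hδ0
    rw [nhds_prod_eq] at hstrict
    exact eventually_swap_iff.1 hstrict
  have hfderiv : ∀ᶠ z in 𝓝 x, ‖fderiv ℝ f z - A‖ < δ := by
    have hcont : ContinuousAt (fderiv ℝ f) x :=
      (hf.fderiv_right (m := 0) (by norm_num)).continuousAt
    simpa only [dist_eq_norm] using Metric.tendsto_nhds.1 hcont δ hδ0
  filter_upwards [hchord, eventually_forall_lineMap_mem hfderiv] with p hchord hseg t ht
  set w := p.2 - p.1
  have hspeed : ‖fderiv ℝ f (lineMap p.1 p.2 t) w - A w‖ ≤ δ * ‖w‖ :=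
    ContinuousLinearMap.le_of_opNorm_le _ (hseg t ht).le w
  have hspeed' := norm_le_norm_add_norm_sub' (fderiv ℝ f (lineMap p.1 p.2 t) w) (A w)
  have hchord' := norm_le_norm_add_norm_sub (f p.2 - f p.1) (A w)
  nlinarith [hδK w]

end Calculus

section Length

attribute [local instance] normedAddCommGroupTangentSpaceVectorSpace
attribute [local instance] normedSpaceTangentSpaceVectorSpace

section NormedSpace

variable {E : Type*} [NormedAddCommGroup E] [NormedSpace ℝ E]

lemma lintegral_enorm_derivWithin_eq_pathELength (c : ℝ → E) (a b : ℝ) :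
    ∫⁻ t in Icc a b, ‖derivWithin c (Icc a b) t‖ₑ = pathELength 𝓘(ℝ, E) c a b := by
  rw [pathELength_eq_lintegral_mfderivWithin_Icc]
  simp only [mfderivWithin_eq_fderivWithin]
  rfl

lemma pathELength_le_of_norm_derivWithin_le {c : ℝ → E} {a b v : ℝ}
    (hv : ∀ t ∈ Icc a b, ‖derivWithin c (Icc a b) t‖ ≤ v) :
    pathELength 𝓘(ℝ, E) c a b ≤ ENNReal.ofReal v * ENNReal.ofReal (b - a) := by
  rw [← lintegral_enorm_derivWithin_eq_pathELength, ← Real.volume_Icc, ← setLIntegral_const]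
  refine setLIntegral_mono measurable_const fun t ht => ?_
  rw [← ofReal_norm]
  exact ENNReal.ofReal_le_ofReal (hv t ht)

lemma exists_contDiff_monotone_eventuallyEq {a b : ℝ} (hab : a < b) :
    ∃ η : ℝ → ℝ, ContDiff ℝ ∞ η ∧ Monotone η ∧ (∀ t, η t ∈ Icc 0 1) ∧
      (∀ᶠ t in 𝓝 a, η t = 0) ∧ ∀ᶠ t in 𝓝 b, η t = 1 := by
  have hba : 0 < b - a := sub_pos.2 hab
  -- This affine map takes the values `-1` and `2` at `a` and `b`.
  set ℓ : ℝ → ℝ := fun t => 3 * ((t - a) / (b - a)) - 1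
  have hℓ : ContDiff ℝ ∞ ℓ := by fun_prop
  refine ⟨fun t => Real.smoothTransition (ℓ t), Real.smoothTransition.contDiff.comp hℓ,
    Real.smoothTransition.monotone.comp fun s t hst => ?_,
    fun t => ⟨Real.smoothTransition.nonneg _, Real.smoothTransition.le_one _⟩, ?_, ?_⟩
  · dsimp only [ℓ]
    gcongr
  · filter_upwards [hℓ.continuous.continuousAt.eventually_lt_const
      (show ℓ a < 0 by simp [ℓ])] with t ht
    exact Real.smoothTransition.zero_of_nonpos ht.le
  · filter_upwards [hℓ.continuous.continuousAt.eventually_const_lt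
      (show 1 < ℓ b by simp only [ℓ, div_self hba.ne']; norm_num)] with t ht
    exact Real.smoothTransition.one_of_one_le ht.le

lemma exists_contDiff_eventuallyEq_endpoints {c : ℝ → E} (hc : ContDiffOn ℝ 1 c (Icc 0 1))
    {a b : ℝ} (hab : a < b) :
    ∃ c' : ℝ → E, ContDiff ℝ 1 c' ∧ (∀ t, c' t ∈ c '' Icc 0 1) ∧
      pathELength 𝓘(ℝ, E) c' a b = pathELength 𝓘(ℝ, E) c 0 1 ∧
      (∀ᶠ t in 𝓝 a, c' t = c 0) ∧ ∀ᶠ t in 𝓝 b, c' t = c 1 := by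
  obtain ⟨η, hη, hmono, hmem, ha, hb⟩ := exists_contDiff_monotone_eventuallyEq hab
  have hη₁ : ContDiff ℝ 1 η := hη.of_le (by norm_cast)
  refine ⟨c ∘ η, ?_, fun t => mem_image_of_mem c (hmem t), ?_, ?_, ?_⟩
  · rw [← contDiffOn_univ]
    exact hc.comp hη₁.contDiffOn fun t _ => hmem t
  · have hlength := pathELength_comp_of_monotoneOn (I := 𝓘(ℝ, E)) (γ := c) hab.le
      (hmono.monotoneOn _) (hη₁.differentiable one_ne_zero).differentiableOn
    rw [ha.self_of_nhds, hb.self_of_nhds] at hlength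
    exact hlength (hc.differentiableOn one_ne_zero).mdifferentiableOn
  · filter_upwards [ha] with t ht using congrArg c ht
  · filter_upwards [hb] with t ht using congrArg c ht

end NormedSpace

variable {S : Set E3}

lemma surfaceEDist_le_pathELength {a b : ℝ} (hab : a ≤ b) {c : ℝ → E3}
    (hc : ContDiffOn ℝ 1 c (Icc a b)) (hcS : MapsTo c (Icc a b) S) :
    surfaceEDist S (c a) (c b) ≤ pathELength 𝓘(ℝ, E3) c a b := by
  set η : ℝ → ℝ := ⇑(lineMap a b : ℝ →ᵃ[ℝ] ℝ)
  have hη : ContDiff ℝ 1 η := contDiff_lineMap a b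
  have hmono : Monotone η := lineMap_mono hab
  have hmaps : MapsTo η (Icc 0 1) (Icc a b) := fun t ht =>
    (convex_Icc a b).lineMap_mem (left_mem_Icc.2 hab) (right_mem_Icc.2 hab) ht
  have hη₀ : η 0 = a := lineMap_apply_zero a b
  have hη₁ : η 1 = b := lineMap_apply_one a b
  calc surfaceEDist S (c a) (c b) ≤ pathELength 𝓘(ℝ, E3) (c ∘ η) 0 1 := by
        rw [← lintegral_enorm_derivWithin_eq_pathELength]
        exact iInf₂_le _ ⟨hc.comp hη.contDiffOn hmaps, fun t ht => hcS (hmaps ht),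
          congrArg c hη₀, congrArg c hη₁⟩
    _ = pathELength 𝓘(ℝ, E3) c (η 0) (η 1) := by
        refine pathELength_comp_of_monotoneOn zero_le_one (hmono.monotoneOn _)
          (hη.differentiable one_ne_zero).differentiableOn ?_
        rw [hη₀, hη₁]
        exact (hc.differentiableOn one_ne_zero).mdifferentiableOn
    _ = pathELength 𝓘(ℝ, E3) c a b := by rw [hη₀, hη₁]

lemma surfaceEDist_le_ofReal_mul {a b v : ℝ} (hab : a ≤ b) {c : ℝ → E3}
    (hc : ContDiffOn ℝ 1 c (Icc a b)) (hcS : MapsTo c (Icc a b) S)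
    (hv : ∀ t ∈ Icc a b, ‖derivWithin c (Icc a b) t‖ ≤ v) :
    surfaceEDist S (c a) (c b) ≤ ENNReal.ofReal v * ENNReal.ofReal (b - a) :=
  (surfaceEDist_le_pathELength hab hc hcS).trans (pathELength_le_of_norm_derivWithin_le hv)

lemma surfaceEDist_le_pathELength_add {c₁ c₂ : ℝ → E3} (hc₁ : ContDiffOn ℝ 1 c₁ (Icc 0 1))
    (hc₁S : MapsTo c₁ (Icc 0 1) S) (hc₂ : ContDiffOn ℝ 1 c₂ (Icc 0 1))
    (hc₂S : MapsTo c₂ (Icc 0 1) S) (h : c₁ 1 = c₂ 0) :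
    surfaceEDist S (c₁ 0) (c₂ 1) ≤
      pathELength 𝓘(ℝ, E3) c₁ 0 1 + pathELength 𝓘(ℝ, E3) c₂ 0 1 := by
  -- Stopping both curves at the junction makes their concatenation continuously differentiable.
  obtain ⟨d₁, hd₁, hd₁S, hlen₁, hd₁0, hd₁1⟩ :=
    exists_contDiff_eventuallyEq_endpoints hc₁ zero_lt_one
  obtain ⟨d₂, hd₂, hd₂S, hlen₂, hd₂1, hd₂2⟩ :=
    exists_contDiff_eventuallyEq_endpoints hc₂ one_lt_two
  set d : ℝ → E3 := (Iic 1).piecewise d₁ d₂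
  have hd_left : EqOn d d₁ (Iic 1) := piecewise_eqOn _ _ _
  have hd_right : EqOn d d₂ (Ioi 1) := compl_Iic (a := (1 : ℝ)) ▸ piecewise_eqOn_compl _ _ _
  have hd : ContDiff ℝ 1 d := by
    have hglue : d₁ =ᶠ[𝓝 1] d₂ := by
      filter_upwards [hd₁1, hd₂1] with t ht₁ ht₂ using ht₁.trans (h.trans ht₂.symm)
    exact contMDiff_iff_contDiff.1 (hd₁.contMDiff.piecewise_Iic hd₂.contMDiff hglue)
  have hdS (t : ℝ) : d t ∈ S := by
    rcases le_or_gt t 1 with ht | ht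
    · exact hd_left ht ▸ hc₁S.image_subset (hd₁S t)
    · exact hd_right ht ▸ hc₂S.image_subset (hd₂S t)
  calc surfaceEDist S (c₁ 0) (c₂ 1) = surfaceEDist S (d 0) (d 2) := by
        rw [hd_left (show (0 : ℝ) ≤ 1 by norm_num), hd_right (show (1 : ℝ) < 2 by norm_num),
          hd₁0.self_of_nhds, hd₂2.self_of_nhds]
    _ ≤ pathELength 𝓘(ℝ, E3) d 0 2 :=
        surfaceEDist_le_pathELength zero_le_two hd.contDiffOn fun t _ => hdS t
    _ = pathELength 𝓘(ℝ, E3) d 0 1 + pathELength 𝓘(ℝ, E3) d 1 2 :=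
        (pathELength_add zero_le_one one_le_two).symm
    _ = pathELength 𝓘(ℝ, E3) c₁ 0 1 + pathELength 𝓘(ℝ, E3) c₂ 0 1 := by
        rw [← hlen₁, ← hlen₂, pathELength_congr (hd_left.mono Icc_subset_Iic_self),
          pathELength_congr_Ioo (hd_right.mono Ioo_subset_Ioi_self)]

lemma surfaceEDist_triangle (S : Set E3) (p q r : E3) :
    surfaceEDist S p r ≤ surfaceEDist S p q + surfaceEDist S q r := by
  rw [surfaceEDist.eq_def S p q, surfaceEDist.eq_def S q r]
  simp only [ENNReal.iInf_add, ENNReal.add_iInf, le_iInf_iff]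
  rintro c₂ ⟨hc₂, hc₂S, h, rfl⟩ c₁ ⟨hc₁, hc₁S, rfl, rfl⟩
  simp only [lintegral_enorm_derivWithin_eq_pathELength]
  exact surfaceEDist_le_pathELength_add hc₁ hc₁S hc₂ hc₂S h.symm

end Length

section Surface

/-- `Φ` is a slice chart of `S` of class `C^n`: a diffeomorphism between open subsets of `ℝ³`
straightening `S` to the coordinate plane `{q | q 2 = 0}`, as in the definition of `IsSurface`. -/
structure IsSliceChart (n : WithTop ℕ∞) (S : Set E3) (Φ : OpenPartialHomeomorph E3 E3) :
    Prop where
  contDiffOn : ContDiffOn ℝ n Φ Φ.source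
  contDiffOn_symm : ContDiffOn ℝ n Φ.symm Φ.target
  mem_iff : ∀ q ∈ Φ.source, q ∈ S ↔ Φ q 2 = 0

/-- The third coordinate of a slice chart, a local defining function of the surface. -/
def normalCoord (Φ : OpenPartialHomeomorph E3 E3) (q : E3) : ℝ := Φ q 2

variable {m n : WithTop ℕ∞} {S : Set E3} {Φ : OpenPartialHomeomorph E3 E3} {x q P Q : E3}

lemma IsSurface.of_le (hS : IsSurface n S) (hmn : m ≤ n) : IsSurface m S := fun p hp =>
  let ⟨Φ, hpΦ, hΦ, hΦ', hiff⟩ := hS p hp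
  ⟨Φ, hpΦ, hΦ.of_le hmn, hΦ'.of_le hmn, hiff⟩

lemma IsSurface.exists_isSliceChart (hS : IsSurface n S) (hx : x ∈ S) :
    ∃ Φ, IsSliceChart n S Φ ∧ x ∈ Φ.source :=
  let ⟨Φ, hxΦ, hΦ, hΦ', hiff⟩ := hS x hx
  ⟨Φ, ⟨hΦ, hΦ', hiff⟩, hxΦ⟩

namespace IsSliceChart

lemma contDiffAt (hΦ : IsSliceChart n S Φ) (hq : q ∈ Φ.source) : ContDiffAt ℝ n Φ q :=
  hΦ.contDiffOn.contDiffAt (Φ.open_source.mem_nhds hq)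

lemma contDiffAt_symm (hΦ : IsSliceChart n S Φ) (hP : P ∈ Φ.target) : ContDiffAt ℝ n Φ.symm P :=
  hΦ.contDiffOn_symm.contDiffAt (Φ.open_target.mem_nhds hP)

lemma symm_mem (hΦ : IsSliceChart n S Φ) (hP : P ∈ Φ.target) (hP₂ : P 2 = 0) : Φ.symm P ∈ S := by
  rwa [hΦ.mem_iff _ (Φ.map_target hP), Φ.right_inv hP]

lemma fderiv_symm_comp_fderiv (hΦ : IsSliceChart n S Φ) (hn : n ≠ 0) (hq : q ∈ Φ.source) :
    (fderiv ℝ Φ.symm (Φ q)).comp (fderiv ℝ Φ q) = .id ℝ E3 :=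
  fderiv_comp_fderiv_of_eventually_leftInverse ((hΦ.contDiffAt hq).differentiableAt hn)
    ((hΦ.contDiffAt_symm (Φ.map_source hq)).differentiableAt hn) (Φ.eventually_left_inverse hq)

lemma fderiv_comp_fderiv_symm (hΦ : IsSliceChart n S Φ) (hn : n ≠ 0) (hq : q ∈ Φ.source) :
    (fderiv ℝ Φ q).comp (fderiv ℝ Φ.symm (Φ q)) = .id ℝ E3 := by
  have hP := Φ.map_source hq
  have hcomp := fderiv_comp_fderiv_of_eventually_leftInverse
    ((hΦ.contDiffAt_symm hP).differentiableAt hn)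
    ((hΦ.contDiffAt (Φ.map_target hP)).differentiableAt hn) (Φ.eventually_right_inverse hP)
  rwa [Φ.left_inv hq] at hcomp

lemma contDiffAt_normalCoord (hΦ : IsSliceChart n S Φ) (hq : q ∈ Φ.source) :
    ContDiffAt ℝ n (normalCoord Φ) q :=
  (EuclideanSpace.proj (𝕜 := ℝ) (2 : Fin 3)).contDiff.contDiffAt.comp q (hΦ.contDiffAt hq)

lemma eventually_normalCoord_eq_zero (hΦ : IsSliceChart n S Φ) (hq : q ∈ Φ.source) :
    ∀ᶠ p in 𝓝[S] q, normalCoord Φ p = 0 := by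
  filter_upwards [mem_nhdsWithin_of_mem_nhds (Φ.open_source.mem_nhds hq), self_mem_nhdsWithin]
    with p hpΦ hpS using (hΦ.mem_iff p hpΦ).1 hpS

lemma fderiv_normalCoord_apply (hΦ : IsSliceChart n S Φ) (hn : n ≠ 0) (hq : q ∈ Φ.source)
    (v : E3) : fderiv ℝ (normalCoord Φ) q v = fderiv ℝ Φ q v 2 := by
  have hcomp := (EuclideanSpace.proj (𝕜 := ℝ) (2 : Fin 3)).hasFDerivAt.comp q
    ((hΦ.contDiffAt hq).differentiableAt hn).hasFDerivAt
  exact DFunLike.congr_fun hcomp.fderiv v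

lemma fderiv_normalCoord_ne_zero (hΦ : IsSliceChart n S Φ) (hn : n ≠ 0) (hq : q ∈ Φ.source) :
    fderiv ℝ (normalCoord Φ) q ≠ 0 := by
  intro h
  set e : E3 := EuclideanSpace.single 2 1
  have he : fderiv ℝ Φ q (fderiv ℝ Φ.symm (Φ q) e) = e :=
    DFunLike.congr_fun (hΦ.fderiv_comp_fderiv_symm hn hq) e
  have he₂ := hΦ.fderiv_normalCoord_apply hn hq (fderiv ℝ Φ.symm (Φ q) e)
  rw [h, he] at he₂
  simp [e] at he₂

lemma mem_tangentSet (hΦ : IsSliceChart ∞ S Φ) (hq : q ∈ Φ.source) (hqS : q ∈ S) {v : E3}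
    (hv : fderiv ℝ (normalCoord Φ) q v = 0) : v ∈ tangentSet S q := by
  set ℓ : ℝ → E3 := fun t => Φ q + t • fderiv ℝ Φ q v
  have hℓ₀ : ℓ 0 = Φ q := by simp [ℓ]
  have hℓ : HasDerivAt ℓ (fderiv ℝ Φ q v) 0 := by
    simpa [ℓ] using (hasDerivAt_id (0 : ℝ)).smul_const (fderiv ℝ Φ q v)
  have hℓ₂ (t : ℝ) : ℓ t 2 = 0 := by
    simp [ℓ, (hΦ.mem_iff q hq).1 hqS, ← hΦ.fderiv_normalCoord_apply (by simp) hq, hv]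
  have hsymm : ContDiffAt ℝ ∞ Φ.symm (ℓ 0) := hℓ₀ ▸ hΦ.contDiffAt_symm (Φ.map_source hq)
  have hderiv : HasDerivAt (Φ.symm ∘ ℓ) v 0 := by
    have hcomp := (hsymm.differentiableAt (by simp)).hasFDerivAt.comp_hasDerivAt 0 hℓ
    rwa [hℓ₀, ← ContinuousLinearMap.comp_apply, hΦ.fderiv_symm_comp_fderiv (by simp) hq] at hcomp
  refine ⟨Φ.symm ∘ ℓ, hsymm.comp 0 (by fun_prop), ?_, ?_, hderiv.deriv⟩
  · filter_upwards [hℓ.continuousAt.eventually_mem (Φ.open_target.mem_nhds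
      (hℓ₀ ▸ Φ.map_source hq))] with t ht using hΦ.symm_mem ht (hℓ₂ t)
  · rw [Function.comp_apply, hℓ₀, Φ.left_inv hq]

lemma antilipschitzWith_fderiv_symm (hΦ : IsSliceChart n S Φ) (hn : n ≠ 0) (hq : q ∈ Φ.source) :
    AntilipschitzWith ‖fderiv ℝ Φ q‖₊ (fderiv ℝ Φ.symm (Φ q)) :=
  (fderiv ℝ Φ q).lipschitz.to_rightInverse
    (DFunLike.congr_fun (hΦ.fderiv_comp_fderiv_symm hn hq))

lemma surfaceEDist_symm_le (hΦ : IsSliceChart 1 S Φ) (hP : P 2 = 0) (hQ : Q 2 = 0)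
    (hPQ : ∀ t ∈ Icc (0 : ℝ) 1, lineMap P Q t ∈ Φ.target) {v : ℝ}
    (hv : ∀ t ∈ Icc (0 : ℝ) 1, ‖fderiv ℝ Φ.symm (lineMap P Q t) (Q - P)‖ ≤ v) :
    surfaceEDist S (Φ.symm P) (Φ.symm Q) ≤ ENNReal.ofReal v := by
  set c : ℝ → E3 := Φ.symm ∘ lineMap P Q
  have hc : ContDiffOn ℝ 1 c (Icc 0 1) :=
    hΦ.contDiffOn_symm.comp (contDiff_lineMap P Q).contDiffOn hPQ
  have hcS : MapsTo c (Icc 0 1) S := fun t ht =>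
    hΦ.symm_mem (hPQ t ht) (by simp [lineMap_apply_module, hP, hQ])
  have hderiv : ∀ t ∈ Icc (0 : ℝ) 1, ‖derivWithin c (Icc 0 1) t‖ ≤ v := by
    intro t ht
    have hct := ((hΦ.contDiffAt_symm (hPQ t ht)).differentiableAt one_ne_zero).hasFDerivAt
      |>.comp_hasDerivAt t hasDerivAt_lineMap
    rw [hct.hasDerivWithinAt.derivWithin (uniqueDiffOn_Icc_zero_one t ht)]
    exact hv t ht
  simpa [c] using surfaceEDist_le_ofReal_mul zero_le_one hc hcS hderiv

end IsSliceChart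

lemma IsSurface.eventually_surfaceEDist_le (hS : IsSurface 1 S) (hx : x ∈ S) {C : ℝ}
    (hC : 1 < C) :
    ∀ᶠ p in 𝓝[S] x ×ˢ 𝓝[S] x, surfaceEDist S p.1 p.2 ≤ ENNReal.ofReal (C * ‖p.2 - p.1‖) := by
  obtain ⟨Φ, hΦ, hxΦ⟩ := hS.exists_isSliceChart hx
  have hΦx := Φ.map_source hxΦ
  have hspeed := eventually_norm_fderiv_lineMap_le (hΦ.contDiffAt_symm hΦx)
    (hΦ.antilipschitzWith_fderiv_symm one_ne_zero hxΦ) hC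
  have hseg := eventually_forall_lineMap_mem (Φ.open_target.mem_nhds hΦx)
  have htend : Tendsto Φ (𝓝[S] x) (𝓝 (Φ x)) :=
    (hΦ.contDiffAt hxΦ).continuousAt.tendsto.mono_left nhdsWithin_le_nhds
  have hmem : S ∩ Φ.source ∈ 𝓝[S] x :=
    inter_mem_nhdsWithin S (Φ.open_source.mem_nhds hxΦ)
  filter_upwards [(htend.prodMap htend).eventually (hspeed.and hseg), prod_mem_prod hmem hmem]
    with p ⟨hspeed, hseg⟩ ⟨⟨hp₁S, hp₁⟩, ⟨hp₂S, hp₂⟩⟩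
  simp only [Prod.map_fst, Prod.map_snd, Φ.left_inv hp₁, Φ.left_inv hp₂] at hspeed hseg
  have hle := hΦ.surfaceEDist_symm_le ((hΦ.mem_iff _ hp₁).1 hp₁S) ((hΦ.mem_iff _ hp₂).1 hp₂S)
    hseg hspeed
  rwa [Φ.left_inv hp₁, Φ.left_inv hp₂] at hle

lemma IsSurface.eventually_surfaceEDist_le_of_hasDerivWithinAt (hS : IsSurface 1 S) (hx : x ∈ S)
    {y z : ℝ → E3} {v w : E3} {T : Set ℝ} (hy : HasDerivWithinAt y v T 0)
    (hz : HasDerivWithinAt z w T 0) (hy₀ : y 0 = x) (hz₀ : z 0 = x)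
    (hyS : ∀ᶠ t in 𝓝[T] 0, y t ∈ S) (hzS : ∀ᶠ t in 𝓝[T] 0, z t ∈ S) {a : ℝ}
    (ha : ‖v - w‖ < a) :
    ∀ᶠ t in 𝓝[T] 0, surfaceEDist S (z t) (y t) ≤ ENNReal.ofReal (a * |t|) := by
  obtain ⟨b, hvwb, hba⟩ := exists_between ha
  have hb : 0 < b := (norm_nonneg _).trans_lt hvwb
  have hchord : ∀ᶠ t in 𝓝[T] 0, ‖y t - z t‖ ≤ b * |t| := by
    filter_upwards [(hasDerivWithinAt_iff_isLittleO.1 (hy.sub hz)).def (sub_pos.2 hvwb)] with t ht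
    simp only [Pi.sub_apply, hy₀, hz₀, sub_self, sub_zero, Real.norm_eq_abs] at ht
    calc ‖y t - z t‖ ≤ ‖t • (v - w)‖ + ‖y t - z t - t • (v - w)‖ := norm_le_norm_add_norm_sub' ..
      _ ≤ |t| * ‖v - w‖ + (b - ‖v - w‖) * |t| := by rw [norm_smul, Real.norm_eq_abs]; gcongr
      _ = b * |t| := by ring
  have hyx : Tendsto y (𝓝[T] 0) (𝓝[S] x) :=
    tendsto_nhdsWithin_iff.2 ⟨hy₀ ▸ hy.continuousWithinAt.tendsto, hyS⟩
  have hzx : Tendsto z (𝓝[T] 0) (𝓝[S] x) :=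
    tendsto_nhdsWithin_iff.2 ⟨hz₀ ▸ hz.continuousWithinAt.tendsto, hzS⟩
  filter_upwards [hchord,
    (hzx.prodMk hyx).eventually (hS.eventually_surfaceEDist_le hx ((one_lt_div hb).2 hba))]
    with t hchord hdist
  refine hdist.trans (ENNReal.ofReal_le_ofReal ?_)
  calc a / b * ‖y t - z t‖ ≤ a / b * (b * |t|) := by
        have := (hb.trans hba).le
        gcongr
    _ = a * |t| := by field_simp

end Surface

section Geodesic

/-- The acceleration in `ℝ³` at time `t` of a curve defined on `[0, L]` (one-sided at the end
points). -/
noncomputable abbrev acceleration (L : ℝ) (c : ℝ → E3) (t : ℝ) : E3 :=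
  derivWithin (velocity L c) (Icc 0 L) t

variable {S : Set E3} {L : ℝ} {c : ℝ → E3} {t : ℝ}

namespace IsGeodesic

lemma hasDerivWithinAt (hc : IsGeodesic S L c) (ht : t ∈ Icc 0 L) :
    HasDerivWithinAt c (velocity L c t) (Icc 0 L) t :=
  (hc.1.differentiableOn (by norm_num) t ht).hasDerivWithinAt

lemma hasDerivWithinAt_velocity (hc : IsGeodesic S L c) (hL : 0 < L) (ht : t ∈ Icc 0 L) :
    HasDerivWithinAt (velocity L c) (acceleration L c t) (Icc 0 L) t :=
  ((hc.1.derivWithin (m := 1) (uniqueDiffOn_Icc hL) (by norm_num)).differentiableOn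
    one_ne_zero t ht).hasDerivWithinAt

lemma eventually_normalCoord_eq_zero {n : WithTop ℕ∞} {Φ : OpenPartialHomeomorph E3 E3}
    (hΦ : IsSliceChart n S Φ) (hc : IsGeodesic S L c) (ht : t ∈ Icc 0 L) (htΦ : c t ∈ Φ.source) :
    ∀ᶠ τ in 𝓝[Icc 0 L] t, normalCoord Φ (c τ) = 0 :=
  (tendsto_nhdsWithin_iff.2 ⟨(hc.hasDerivWithinAt ht).continuousWithinAt,
    eventually_mem_nhdsWithin.mono fun τ hτ => (hc.2 τ hτ).1⟩).eventually
    (hΦ.eventually_normalCoord_eq_zero htΦ)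

lemma velocity_mem_tangentSet (hS : IsSurface ∞ S) (hc : IsGeodesic S L c) (ht : t ∈ Icc 0 L) :
    velocity L c t ∈ tangentSet S (c t) := by
  obtain ⟨Φ, hΦ, htΦ⟩ := hS.exists_isSliceChart (hc.2 t ht).1
  exact hΦ.mem_tangentSet htΦ (hc.2 t ht).1 <| fderiv_derivWithin_eq_zero_of_eventually
    ((hΦ.contDiffAt_normalCoord htΦ).differentiableAt (by simp))
    (hc.hasDerivWithinAt ht).differentiableWithinAt ht (hc.eventually_normalCoord_eq_zero hΦ ht htΦ)

lemma norm_velocity_eq (hS : IsSurface ∞ S) (hc : IsGeodesic S L c) (hL : 0 < L)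
    (ht : t ∈ Icc 0 L) : ‖velocity L c t‖ = ‖velocity L c 0‖ := by
  have hderiv (s) (hs : s ∈ Icc 0 L) :
      HasDerivWithinAt (fun s => ‖velocity L c s‖ ^ 2) 0 (Icc 0 L) s := by
    have hsq := (hc.hasDerivWithinAt_velocity hL hs).norm_sq
    rwa [real_inner_comm, (hc.2 s hs).2 _ (hc.velocity_mem_tangentSet hS hs), mul_zero] at hsq
  have hconst : ‖velocity L c t‖ ^ 2 = ‖velocity L c 0‖ ^ 2 :=
    constant_of_derivWithin_zero (fun s hs => (hderiv s hs).differentiableWithinAt)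
      (fun s hs => (hderiv s (Ico_subset_Icc_self hs)).derivWithin
        (uniqueDiffOn_Icc hL s (Ico_subset_Icc_self hs))) t ht
  exact (sq_eq_sq₀ (norm_nonneg _) (norm_nonneg _)).1 hconst

lemma norm_sub_le (hS : IsSurface ∞ S) (hc : IsGeodesic S L c) (hL : 0 < L) (ht : t ∈ Icc 0 L) :
    ‖c t - c 0‖ ≤ ‖velocity L c 0‖ * t := by
  simpa [abs_of_nonneg ht.1] using Convex.norm_image_sub_le_of_norm_hasDerivWithin_le
    (fun s hs => hc.hasDerivWithinAt hs) (fun s hs => (hc.norm_velocity_eq hS hL hs).le)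
    (convex_Icc 0 L) (left_mem_Icc.2 hL.le) ht

/-- Differentiating `F (c t) = 0` twice, for `F = normalCoord Φ`, shows that `fderiv ℝ F (c t)`
sends the acceleration to `-D²F (velocity, velocity)`; it loses no norm, as the acceleration is
orthogonal to its kernel, the tangent plane. -/
lemma norm_fderiv_normalCoord_mul_norm_acceleration_le {Φ : OpenPartialHomeomorph E3 E3}
    (hΦ : IsSliceChart ∞ S Φ) (hc : IsGeodesic S L c) (hL : 0 < L) (ht : t ∈ Icc 0 L)
    (htΦ : c t ∈ Φ.source) :
    ‖fderiv ℝ (normalCoord Φ) (c t)‖ * ‖acceleration L c t‖ ≤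
      ‖fderiv ℝ (fderiv ℝ (normalCoord Φ)) (c t)‖ * ‖velocity L c t‖ ^ 2 := by
  set F := normalCoord Φ
  have horth : acceleration L c t ∈ (fderiv ℝ F (c t)).kerᗮ :=
    (Submodule.mem_orthogonal' _ _).2 fun w hw =>
      (hc.2 t ht).2 w (hΦ.mem_tangentSet htΦ (hc.2 t ht).1 hw)
  have hsecond : fderiv ℝ (fderiv ℝ F) (c t) (velocity L c t) (velocity L c t) +
      fderiv ℝ F (c t) (acceleration L c t) = 0 :=
    fderiv_fderiv_add_fderiv_eq_zero_of_eventually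
      ((hΦ.contDiffAt_normalCoord htΦ).of_le (by norm_cast)) (uniqueDiffOn_Icc hL) hc.1 ht
      (hc.eventually_normalCoord_eq_zero hΦ ht htΦ)
  rw [← norm_apply_of_mem_orthogonal_ker _ horth, ← neg_eq_of_add_eq_zero_right hsecond, norm_neg,
    sq, ← mul_assoc]
  exact ContinuousLinearMap.le_opNorm₂ ..

end IsGeodesic

variable {x : E3}

lemma IsSurface.exists_norm_acceleration_le (hS : IsSurface ∞ S) (hx : x ∈ S) :
    ∃ C, ∃ U ∈ 𝓝 x, ∀ ⦃L c⦄, IsGeodesic S L c → 0 < L → ∀ t ∈ Icc 0 L, c t ∈ U →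
      ‖acceleration L c t‖ ≤ C * ‖velocity L c t‖ ^ 2 := by
  obtain ⟨Φ, hΦ, hxΦ⟩ := hS.exists_isSliceChart hx
  set F := normalCoord Φ
  have hF' : ContDiffAt ℝ 1 (fderiv ℝ F) x :=
    (hΦ.contDiffAt_normalCoord hxΦ).fderiv_right (by norm_cast)
  have hF'' : ContinuousAt (fderiv ℝ (fderiv ℝ F)) x :=
    (hF'.fderiv_right (m := 0) (by norm_num)).continuousAt
  have hquot : ContinuousAt (fun q => ‖fderiv ℝ (fderiv ℝ F) q‖ / ‖fderiv ℝ F q‖) x :=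
    (ContinuousAt.norm (E := E3 →L[ℝ] E3 →L[ℝ] ℝ) hF'').div hF'.continuousAt.norm
      (norm_ne_zero_iff.2 (hΦ.fderiv_normalCoord_ne_zero (by simp) hxΦ))
  obtain ⟨C, hC⟩ := exists_gt (‖fderiv ℝ (fderiv ℝ F) x‖ / ‖fderiv ℝ F x‖)
  refine ⟨C, _, (hquot.eventually_lt_const hC).and (Φ.open_source.mem_nhds hxΦ), ?_⟩
  rintro L c hc hL t ht ⟨hlt, htΦ⟩
  have hpos : 0 < ‖fderiv ℝ F (c t)‖ :=
    norm_pos_iff.2 (hΦ.fderiv_normalCoord_ne_zero (by simp) htΦ)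
  calc ‖acceleration L c t‖
      ≤ ‖fderiv ℝ (fderiv ℝ F) (c t)‖ / ‖fderiv ℝ F (c t)‖ * ‖velocity L c t‖ ^ 2 := by
        rw [div_mul_eq_mul_div, le_div_iff₀' hpos]
        exact hc.norm_fderiv_normalCoord_mul_norm_acceleration_le hΦ hL ht htΦ
    _ ≤ C * ‖velocity L c t‖ ^ 2 := mul_le_mul_of_nonneg_right hlt.le (sq_nonneg _)

lemma IsSurface.exists_norm_geodesic_sub_le (hS : IsSurface ∞ S) (hx : x ∈ S) :
    ∃ C, ∀ᶠ w in 𝓝 (0 : E3), ∀ c, IsGeodesic S 1 c → c 0 = x → velocity 1 c 0 = w →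
      ‖c 1 - x - w‖ ≤ C * ‖w‖ ^ 2 := by
  obtain ⟨C, U, hU, hC⟩ := hS.exists_norm_acceleration_le hx
  obtain ⟨r, hr, hrU⟩ := Metric.mem_nhds_iff.1 hU
  refine ⟨C, ?_⟩
  filter_upwards [Metric.ball_mem_nhds 0 hr]
  rintro _ hwr c hc rfl rfl
  rw [mem_ball_zero_iff] at hwr
  have hcU : ∀ t ∈ Icc (0 : ℝ) 1, c t ∈ U := fun t ht => hrU <| mem_ball_iff_norm.2 <|
    (hc.norm_sub_le hS one_pos ht).trans_lt <|
      (mul_le_of_le_one_right (norm_nonneg _) ht.2).trans_lt hwr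
  have hacc : ∀ t ∈ Icc (0 : ℝ) 1, ‖acceleration 1 c t‖ ≤ C * ‖velocity 1 c 0‖ ^ 2 :=
    fun t ht => hc.norm_velocity_eq hS one_pos ht ▸ hC hc one_pos t ht (hcU t ht)
  simpa [velocity] using norm_sub_sub_smul_derivWithin_le one_pos hc.1 hacc

end Geodesic

section ExponentialMap

/-- The domain of the exponential map of `S` at `x`, outside which `expMap S x` takes the default
value `x`. -/
def expDomain (S : Set E3) (x : E3) : Set E3 :=
  {w | ∃ c : ℝ → E3, IsGeodesic S 1 c ∧ c 0 = x ∧ velocity 1 c 0 = w}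

variable {S : Set E3} {x w : E3}

lemma expMap_of_notMem_expDomain (hw : w ∉ expDomain S x) : expMap S x w = x := dif_neg hw

lemma exists_isGeodesic_of_mem_expDomain (hw : w ∈ expDomain S x) :
    ∃ c, IsGeodesic S 1 c ∧ c 0 = x ∧ velocity 1 c 0 = w ∧ c 1 = expMap S x w := by
  rw [expDomain, mem_ofPred_eq] at hw
  obtain ⟨hc, hc₀, hv⟩ := hw.choose_spec
  exact ⟨_, hc, hc₀, hv, by rw [expMap, dif_pos hw]⟩

lemma expMap_mem (hw : w ∈ expDomain S x) : expMap S x w ∈ S := by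
  obtain ⟨c, hc, -, -, hc₁⟩ := exists_isGeodesic_of_mem_expDomain hw
  exact hc₁ ▸ (hc.2 1 (right_mem_Icc.2 zero_le_one)).1

lemma IsSurface.expMap_zero (hS : IsSurface ∞ S) : expMap S x 0 = x := by
  by_cases h₀ : (0 : E3) ∈ expDomain S x
  · obtain ⟨c, hc, rfl, hv, hc₁⟩ := exists_isGeodesic_of_mem_expDomain h₀
    have hle := hc.norm_sub_le hS one_pos (right_mem_Icc.2 zero_le_one)
    rw [hv, norm_zero, zero_mul, norm_le_zero_iff, sub_eq_zero] at hle
    rw [← hc₁, hle]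
  · exact expMap_of_notMem_expDomain h₀

lemma IsSurface.hasFDerivWithinAt_expMap (hS : IsSurface ∞ S) (hx : x ∈ S) :
    HasFDerivWithinAt (expMap S x) (.id ℝ E3) (expDomain S x) 0 := by
  obtain ⟨C, hC⟩ := hS.exists_norm_geodesic_sub_le hx
  refine .of_isLittleO ?_
  simp only [sub_zero, hS.expMap_zero, ContinuousLinearMap.id_apply]
  refine (Asymptotics.IsBigO.of_bound C ?_).trans_isLittleO <|
    (Asymptotics.isLittleO_norm_pow_id one_lt_two).mono nhdsWithin_le_nhds
  filter_upwards [mem_nhdsWithin_of_mem_nhds hC, self_mem_nhdsWithin] with w hCw hw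
  obtain ⟨c, hc, hc₀, hv, hc₁⟩ := exists_isGeodesic_of_mem_expDomain hw
  simpa [hc₁] using hCw c hc hc₀ hv

lemma IsSurface.hasDerivWithinAt_expMap_smul (hS : IsSurface ∞ S) (hx : x ∈ S) (v : E3) :
    HasDerivWithinAt (fun t : ℝ => expMap S x (t • v)) v ((· • v) ⁻¹' expDomain S x) 0 := by
  have hline : HasDerivWithinAt (fun t : ℝ => t • v) v ((· • v) ⁻¹' expDomain S x) 0 := by
    simpa using (hasDerivWithinAt_id (0 : ℝ) _).smul_const v
  exact (hS.hasFDerivWithinAt_expMap hx).comp_hasDerivWithinAt_of_eq 0 hline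
    (mapsTo_preimage _ _) (zero_smul ℝ v).symm

end ExponentialMap

section FirstVariation

variable {S : Set E3} {b x : E3} {γ : ℝ → E3}

namespace IsUnitSpeedMinGeodesic

lemma surfaceDist_pos (hγ : IsUnitSpeedMinGeodesic S b x γ) : 0 < surfaceDist S b x := by
  have hnonneg : 0 ≤ surfaceDist S b x := ENNReal.toReal_nonneg
  refine hnonneg.lt_of_ne fun hzero => ?_
  have hspeed := hγ.2.1 _ (right_mem_Icc.2 hnonneg)
  have hacc : ¬ AccPt (0 : ℝ) (𝓟 {0}) := fun h => Set.Infinite.of_accPt h (finite_singleton 0)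
  simp [velocity, ← hzero, derivWithin_zero_of_not_accPt hacc] at hspeed

lemma mem (hγ : IsUnitSpeedMinGeodesic S b x γ) : x ∈ S :=
  hγ.2.2.2 ▸ (hγ.1.2 _ (right_mem_Icc.2 hγ.surfaceDist_pos.le)).1

lemma surfaceEDist_le (hγ : IsUnitSpeedMinGeodesic S b x γ) {s : ℝ} (hs : 0 < s)
    (hsL : s ≤ surfaceDist S b x) : surfaceEDist S b (γ s) ≤ ENNReal.ofReal s := by
  have hsub : Icc 0 s ⊆ Icc 0 (surfaceDist S b x) := Icc_subset_Icc_right hsL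
  have hspeed : ∀ t ∈ Icc 0 s, ‖derivWithin γ (Icc 0 s) t‖ ≤ 1 := fun t ht => by
    rw [((hγ.1.hasDerivWithinAt (hsub ht)).mono hsub).derivWithin (uniqueDiffOn_Icc hs t ht)]
    exact (hγ.2.1 t (hsub ht)).le
  simpa [hγ.2.2.1] using surfaceEDist_le_ofReal_mul hs.le
    ((hγ.1.1.mono hsub).of_le (by norm_num)) (fun t ht => (hγ.1.2 t (hsub ht)).1) hspeed

lemma hasDerivWithinAt_comp_sub_mul (hγ : IsUnitSpeedMinGeodesic S b x γ) {k : ℝ} (hk : 0 ≤ k) :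
    HasDerivWithinAt (fun t => γ (surfaceDist S b x - k * t))
      (-k • velocity (surfaceDist S b x) γ (surfaceDist S b x)) (Ici 0) 0 := by
  set L := surfaceDist S b x
  have hL : 0 < L := hγ.surfaceDist_pos
  have hleft : HasDerivWithinAt γ (velocity L γ L) (Iic L) L :=
    (hγ.1.hasDerivWithinAt (right_mem_Icc.2 hL.le)).mono_of_mem_nhdsWithin (Icc_mem_nhdsLE hL)
  have hback : HasDerivWithinAt (fun t => L - k * t) (-k) (Ici 0) 0 := by
    simpa using ((hasDerivWithinAt_id (0 : ℝ) (Ici 0)).const_mul k).const_sub L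
  exact hleft.scomp_of_eq 0 hback (fun t ht => sub_le_self L (mul_nonneg hk ht)) (by simp)

/-- To reach `y t` from `b`, leave `γ` at the parameter `d_b(x) - k t`, with `k` so large that the
chord to `y t`, which is close to `t (k u + v)` for the final velocity `u` of `γ`, is shorter than
`(k + a) t`. -/
lemma eventually_surfaceDist_le (hS : IsSurface 1 S) (hγ : IsUnitSpeedMinGeodesic S b x γ)
    {y : ℝ → E3} {v : E3} {T : Set ℝ} (hT : T ⊆ Ici 0) (hy : HasDerivWithinAt y v T 0)
    (hy₀ : y 0 = x) (hyS : ∀ᶠ t in 𝓝[T] 0, y t ∈ S) {a : ℝ}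
    (ha : inner ℝ (velocity (surfaceDist S b x) γ (surfaceDist S b x)) v < a) :
    ∀ᶠ t in 𝓝[T] 0, surfaceDist S b (y t) ≤ surfaceDist S b x + a * t := by
  set L := surfaceDist S b x
  have hL : 0 < L := hγ.surfaceDist_pos
  obtain ⟨k, hchord, hk⟩ := ((eventually_norm_smul_add_lt (hγ.2.1 L (right_mem_Icc.2 hL.le))
    ha).and (eventually_ge_atTop 0)).exists
  have hparam : ∀ᶠ t in 𝓝[T] 0, 0 < L - k * t ∧ L - k * t ≤ L := by
    have hcont : ContinuousAt (fun t => L - k * t) 0 := by fun_prop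
    filter_upwards [nhdsWithin_le_nhds (hcont.eventually_const_lt (by simpa using hL)),
      self_mem_nhdsWithin] with t hpos ht
    exact ⟨hpos, sub_le_self L (mul_nonneg hk (hT ht))⟩
  have hγS : ∀ᶠ t in 𝓝[T] 0, γ (L - k * t) ∈ S :=
    hparam.mono fun t ht => (hγ.1.2 _ ⟨ht.1.le, ht.2⟩).1
  filter_upwards [hparam, self_mem_nhdsWithin,
    hS.eventually_surfaceEDist_le_of_hasDerivWithinAt hγ.mem hy
      ((hγ.hasDerivWithinAt_comp_sub_mul hk).mono hT) hy₀ (by simpa using hγ.2.2.2) hyS hγS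
      (by rwa [neg_smul, sub_neg_eq_add, add_comm])] with t ⟨hpos, hle⟩ ht hshort
  rw [abs_of_nonneg (hT ht)] at hshort
  have hka : 0 ≤ (k + a) * t := mul_nonneg ((norm_nonneg _).trans hchord.le) (hT ht)
  calc surfaceDist S b (y t) ≤ (L - k * t) + (k + a) * t := by
        refine ENNReal.toReal_le_of_le_ofReal (by positivity) ?_
        rw [ENNReal.ofReal_add hpos.le hka]
        exact (surfaceEDist_triangle S b _ _).trans
          (add_le_add (hγ.surfaceEDist_le hpos hle) hshort)
    _ = L + a * t := by ring

/-- The value `0` in the maximum comes from the `t` for which `expMap S x (t • v)` is the default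
value `x`. -/
lemma dirDeriv_surfaceDist_le (hS : IsSurface ∞ S) (hγ : IsUnitSpeedMinGeodesic S b x γ) (v : E3) :
    dirDeriv S (surfaceDist S b) x v ≤
      ↑(max 0 (inner ℝ (velocity (surfaceDist S b x) γ (surfaceDist S b x)) v)) := by
  refine EReal.le_of_forall_lt_iff_le.1 fun a ha => ?_
  rw [EReal.coe_lt_coe_iff, max_lt_iff] at ha
  set T : Set ℝ := Ici 0 ∩ (· • v) ⁻¹' expDomain S x
  have hvar : ∀ᶠ t in 𝓝[T] 0,
      surfaceDist S b (expMap S x (t • v)) ≤ surfaceDist S b x + a * t :=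
    hγ.eventually_surfaceDist_le (hS.of_le (by norm_cast)) inter_subset_left
      ((hS.hasDerivWithinAt_expMap_smul hγ.mem v).mono inter_subset_right)
      (by rw [zero_smul, hS.expMap_zero])
      (eventually_mem_nhdsWithin.mono fun t ht => expMap_mem ht.2) ha.2
  refine limsup_le_of_le (by isBoundedDefault) ?_
  filter_upwards [nhdsWithin_le_nhds (eventually_nhdsWithin_iff.1 hvar), self_mem_nhdsWithin]
    with t hvar ht
  rw [EReal.coe_le_coe_iff, div_le_iff₀ ht, sub_le_iff_le_add']
  by_cases hexp : t • v ∈ expDomain S x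
  · exact hvar ⟨mem_Ici.2 (le_of_lt ht), hexp⟩
  · rw [expMap_of_notMem_expDomain hexp]
    exact le_add_of_nonneg_right (mul_nonneg ha.1.le (le_of_lt ht))

end IsUnitSpeedMinGeodesic

end FirstVariation

end CutLocus

theorem mainTheorem5_general {n : WithTop ℕ∞} (hn : ∞ ≤ n) {S : Set CutLocus.E3}
    (hS : CutLocus.IsSurface n S) {b x : CutLocus.E3} {γ₁ γ₂ : ℝ → CutLocus.E3}
    (h₁ : CutLocus.IsUnitSpeedMinGeodesic S b x γ₁)
    (h₂ : CutLocus.IsUnitSpeedMinGeodesic S b x γ₂) :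
    CutLocus.genGradNorm S (CutLocus.surfaceDist S b) x ≤
      ((Real.cos (InnerProductGeometry.angle
        (-CutLocus.velocity (CutLocus.surfaceDist S b x) γ₁ (CutLocus.surfaceDist S b x))
        (-CutLocus.velocity (CutLocus.surfaceDist S b x) γ₂ (CutLocus.surfaceDist S b x)) / 2) :
        ℝ) : EReal) := by
  set L := CutLocus.surfaceDist S b x
  have hL : L ∈ Icc 0 L := right_mem_Icc.2 h₁.surfaceDist_pos.le
  have hu₁ := h₁.2.1 L hL
  have hu₂ := h₂.2.1 L hL
  rw [InnerProductGeometry.angle_neg_neg]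
  set u₁ := CutLocus.velocity L γ₁ L
  set u₂ := CutLocus.velocity L γ₂ L
  have hcos : 0 ≤ Real.cos (InnerProductGeometry.angle u₁ u₂ / 2) := by
    linarith [CutLocus.norm_add_eq_two_mul_cos_half_angle hu₁ hu₂, norm_nonneg (u₁ + u₂)]
  refine max_le (EReal.coe_nonneg.2 hcos) (iSup₂_le fun v hv => ?_)
  rcases min_le_iff.1 (CutLocus.min_inner_le_cos_half_angle hu₁ hu₂ hv.2) with hle | hle
  · exact (h₁.dirDeriv_surfaceDist_le (hS.of_le hn) v).trans
      (EReal.coe_le_coe_iff.2 (max_le hcos hle))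
  · exact (h₂.dirDeriv_surfaceDist_le (hS.of_le hn) v).trans
      (EReal.coe_le_coe_iff.2 (max_le hcos hle))

theorem mainTheorem5 (n : WithTop ℕ∞) (hn : ∞ ≤ n) (S : Set CutLocus.E3)
    (hS : CutLocus.IsSurface n S) (b : CutLocus.E3) (hb : b ∈ S)
    (x : CutLocus.E3) (hx : x ∈ CutLocus.cutLocus S b)
    (γ₁ γ₂ : ℝ → CutLocus.E3)
    (h₁ : CutLocus.IsUnitSpeedMinGeodesic S b x γ₁)
    (h₂ : CutLocus.IsUnitSpeedMinGeodesic S b x γ₂)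
    (θ : ℝ) (hθ : θ ∈ Set.Ioo 0 Real.pi)
    (hangle : θ = InnerProductGeometry.angle
      (-CutLocus.velocity (CutLocus.surfaceDist S b x) γ₁ (CutLocus.surfaceDist S b x))
      (-CutLocus.velocity (CutLocus.surfaceDist S b x) γ₂ (CutLocus.surfaceDist S b x))) :
    CutLocus.genGradNorm S (CutLocus.surfaceDist S b) x ≤ ((Real.cos (θ / 2) : ℝ) : EReal) := by
  exact hangle ▸ mainTheorem5_general hn hS h₁ h₂
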